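/- Call a simple graph $G$ a unit ball graph if one can assign to each vertex $v$ a closed ball $B_v$ of radius $1$ in $\mathbb{R}^3$ so that two distinct vertices $u,v$ are adjacent if and only if $B_u\cap B_v\neq\emptyset$. For a graph $H$, let $\mathrm{iocp}(H)$ (the induced odd cycle packing number) be the maximum number of pairwise vertex-disjoint odd cycles of $H$ such that no edge of $H$ joins two of them. Theorem. Let $G$ be a unit ball graph and let $\overline{G}$ be its complement. Then $\overline{G}$ does not contain the disjoint union of two odd cycles as an induced subgraph; that is, for all odd integers $p,q\geq 3$, the disjoint union of the cycles $C_p$ and $C_q$ is not an induced subgraph of $\overline{G}$. In other words, $\mathrm{iocp}(\overline{G})\leq 1$. -/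

import Mathlib

/-- `G` is a `d`-dimensional unit disk graph: its vertices can be represented by closed balls of
radius `1` in the Euclidean space `ℝ^d` so that two distinct vertices are adjacent exactly when
their balls intersect. -/
def IsUnitDiskGraph (d : ℕ) {V : Type*} (G : SimpleGraph V) : Prop :=
  ∃ c : V → EuclideanSpace ℝ (Fin d), ∀ u v : V,
    G.Adj u v ↔ u ≠ v ∧ (Metric.closedBall (c u) 1 ∩ Metric.closedBall (c v) 1).Nonempty

/-- A unit ball graph is a `3`-dimensional unit disk graph. -/
def IsUnitBallGraph {V : Type*} (G : SimpleGraph V) : Prop :=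
  IsUnitDiskGraph 3 G

/-- The family `C` of closed walks consists of odd cycles of `G` that are pairwise
vertex-disjoint and such that no edge of `G` joins two of them. The cycles themselves may have
chords. -/
def IsInducedOddCyclePacking {V : Type*} (G : SimpleGraph V) {k : ℕ}
    (C : Fin k → (v : V) × G.Walk v v) : Prop :=
  (∀ i, (C i).2.IsCycle ∧ Odd (C i).2.length) ∧
    ∀ i j, i ≠ j → ∀ a ∈ (C i).2.support, ∀ b ∈ (C j).2.support, a ≠ b ∧ ¬ G.Adj a b

/-- The induced odd cycle packing number of `G`: the maximum number of vertex-disjoint odd cycles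
with no edge between any two of them (`⊤` if there is no maximum, which needs `G` infinite). -/
noncomputable def iocp {V : Type*} (G : SimpleGraph V) : ℕ∞ :=
  sSup {n : ℕ∞ | ∃ (k : ℕ) (C : Fin k → (v : V) × G.Walk v v),
    IsInducedOddCyclePacking G C ∧ n = k}

/-! In the complement, edges are center distances above 2; suppose two odd closed walks have all
cross distances at most 2. Multiply the steps of each walk by alternating signs: oddness makes the
resulting polygonal curve end at the antipode of its start. Modulo sign, these are two
noncontractible loops in the projective plane, so they meet (`exists_parallel_of_antipodal`): moving
the axis along one curve, the turning angle of the other is continuous and never zero, yet odd in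
the axis. The parallel vectors found join a vertex of each walk to the segment between its two
neighbors, which the distances forbid (`not_parallel_of_far_of_close`). -/

/-! ### Turning angles around an axis -/

/-- The product `conj a * b`, scaled by `‖p‖ ^ 2`, where `a` and `b` are the orthogonal projections
of `u` and `v` to the plane `pᗮ`, seen as the complex plane oriented by `p`. -/
noncomputable def axialProd (p u v : EuclideanSpace ℝ (Fin 3)) : ℂ :=
  ⟨inner ℝ p p * inner ℝ u v - inner ℝ p u * inner ℝ p v,
    ‖p‖ * (p 0 * (u 1 * v 2 - u 2 * v 1) - p 1 * (u 0 * v 2 - u 2 * v 0)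
      + p 2 * (u 0 * v 1 - u 1 * v 0))⟩

theorem inner_fin_three (u v : EuclideanSpace ℝ (Fin 3)) :
    inner ℝ u v = u 0 * v 0 + u 1 * v 1 + u 2 * v 2 := by
  simp [PiLp.inner_apply, Fin.sum_univ_three, mul_comm]

theorem norm_sq_fin_three (u : EuclideanSpace ℝ (Fin 3)) :
    ‖u‖ ^ 2 = u 0 * u 0 + u 1 * u 1 + u 2 * u 2 := by
  rw [← real_inner_self_eq_norm_sq, inner_fin_three]

theorem axialProd_self (p u : EuclideanSpace ℝ (Fin 3)) :
    axialProd p u u = ((‖p‖ ^ 2 * ‖u‖ ^ 2 - inner ℝ p u ^ 2 : ℝ) : ℂ) := by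
  apply Complex.ext
  · simp only [axialProd, Complex.ofReal_re, ← real_inner_self_eq_norm_sq]; ring
  · simp only [axialProd, Complex.ofReal_im]; ring

theorem axialProd_neg_left (p u v : EuclideanSpace ℝ (Fin 3)) :
    axialProd (-p) u v = (starRingEnd ℂ) (axialProd p u v) := by
  apply Complex.ext <;> simp [axialProd]
  ring

theorem axialProd_neg_right (p u v : EuclideanSpace ℝ (Fin 3)) :
    axialProd p u (-v) = -axialProd p u v := by
  apply Complex.ext <;> simp [axialProd] <;> ring

/-- In the complex plane `pᗮ` this is `(conj a * b) * (conj b * c) = (conj b * b) * (conj a * c)`.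
-/
theorem axialProd_mul (p u v w : EuclideanSpace ℝ (Fin 3)) :
    axialProd p u v * axialProd p v w = axialProd p v v * axialProd p u w := by
  have h := norm_sq_fin_three p
  apply Complex.ext
  · simp only [axialProd, Complex.mul_re, inner_fin_three]
    linear_combination (-((p 0 * (u 1 * v 2 - u 2 * v 1) - p 1 * (u 0 * v 2 - u 2 * v 0)
      + p 2 * (u 0 * v 1 - u 1 * v 0)) * (p 0 * (v 1 * w 2 - v 2 * w 1)
      - p 1 * (v 0 * w 2 - v 2 * w 0) + p 2 * (v 0 * w 1 - v 1 * w 0)))) * h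
  · simp only [axialProd, Complex.mul_im, inner_fin_three]
    ring

theorem axialProd_swap (p u v : EuclideanSpace ℝ (Fin 3)) :
    axialProd p v u = (starRingEnd ℂ) (axialProd p u v) := by
  apply Complex.ext
  · simp only [axialProd, Complex.conj_re, inner_fin_three]; ring
  · simp only [axialProd, Complex.conj_im]; ring

/-- If the product of the projections is not in the slit plane, then the segment between the two
vectors meets the axis. -/
theorem exists_parallel_of_axialProd_notMem {p u v : EuclideanSpace ℝ (Fin 3)}
    (h : axialProd p u v ∉ Complex.slitPlane) :
    ∃ t ∈ Set.Icc (0 : ℝ) 1, inner ℝ p ((1 - t) • u + t • v) ^ 2 =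
      ‖p‖ ^ 2 * ‖(1 - t) • u + t • v‖ ^ 2 := by
  rw [Complex.mem_slitPlane_iff] at h
  push Not at h
  obtain ⟨hre, him⟩ := h
  have key := axialProd_mul p u v u
  rw [axialProd_swap p u v, axialProd_self, axialProd_self, Complex.mul_conj,
    ← Complex.ofReal_mul, Complex.ofReal_inj, Complex.normSq_apply, him] at key
  set a := ‖p‖ ^ 2 * ‖u‖ ^ 2 - inner ℝ p u ^ 2 with ha
  set b := ‖p‖ ^ 2 * ‖v‖ ^ 2 - inner ℝ p v ^ 2 with hb
  have cs : ∀ w : EuclideanSpace ℝ (Fin 3), 0 ≤ ‖p‖ ^ 2 * ‖w‖ ^ 2 - inner ℝ p w ^ 2 := by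
    intro w
    have := abs_real_inner_le_norm p w
    rw [sub_nonneg, ← mul_pow, ← sq_abs (inner ℝ p w)]
    gcongr
  have ha0 : 0 ≤ a := cs u
  have hb0 : 0 ≤ b := cs v
  -- The projections point in opposite directions.
  have hc : (axialProd p u v).re = -(√a * √b) := by
    have : (-(axialProd p u v).re) = √(b * a) := by
      rw [eq_comm, Real.sqrt_eq_iff_mul_self_eq (by positivity) (by linarith)]
      linarith
    rw [Real.sqrt_mul hb0] at this
    linarith
  have expand : ∀ t : ℝ, ‖p‖ ^ 2 * ‖(1 - t) • u + t • v‖ ^ 2 -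
      inner ℝ p ((1 - t) • u + t • v) ^ 2 =
      (1 - t) ^ 2 * a + t ^ 2 * b + 2 * (1 - t) * t * (axialProd p u v).re := by
    intro t
    simp only [ha, hb, axialProd, ← real_inner_self_eq_norm_sq, inner_fin_three, PiLp.add_apply,
      PiLp.smul_apply, smul_eq_mul]
    ring
  have hsa := Real.sq_sqrt ha0
  have hsb := Real.sq_sqrt hb0
  have na := Real.sqrt_nonneg a
  have nb := Real.sqrt_nonneg b
  rcases eq_or_lt_of_le (add_nonneg na nb) with h0 | h0
  · have : √a = 0 := by linarith
    refine ⟨0, by simp, ?_⟩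
    have h1 := expand 0
    rw [← hsa, this] at h1
    linarith
  -- Weights proportional to the opposite projected lengths make the projections cancel.
  · refine ⟨√a / (√a + √b), ⟨by positivity, by rw [div_le_one h0]; linarith⟩, ?_⟩
    have h1 := expand (√a / (√a + √b))
    have h2 : 1 - √a / (√a + √b) = √b / (√a + √b) := by field_simp; ring
    have h3 : (1 - √a / (√a + √b)) ^ 2 * a + (√a / (√a + √b)) ^ 2 * b +
        2 * (1 - √a / (√a + √b)) * (√a / (√a + √b)) * (axialProd p u v).re = 0 := by
      rw [h2, hc]
      linear_combination -(√b / (√a + √b)) ^ 2 * hsa - (√a / (√a + √b)) ^ 2 * hsb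
    linarith

/-- The total angle by which the polygonal curve `v 0, …, v n` turns around the axis `p`. -/
noncomputable def axialAngle (v : ℕ → EuclideanSpace ℝ (Fin 3)) (n : ℕ)
    (p : EuclideanSpace ℝ (Fin 3)) : ℝ :=
  ∑ j ∈ Finset.range n, (axialProd p (v j) (v (j + 1))).arg

/-- Conjugation negates `arg` except on the negative real axis, hence the slit plane. -/
theorem axialAngle_neg {v : ℕ → EuclideanSpace ℝ (Fin 3)} {n : ℕ} {p : EuclideanSpace ℝ (Fin 3)}
    (h : ∀ j, axialProd p (v j) (v (j + 1)) ∈ Complex.slitPlane) :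
    axialAngle v n (-p) = -axialAngle v n p := by
  simp only [axialAngle, axialProd_neg_left, ← Finset.sum_neg_distrib]
  refine Finset.sum_congr rfl fun j _ => ?_
  rw [Complex.arg_conj, if_neg (Complex.mem_slitPlane_iff_arg.1 (h j)).1]

theorem exists_prod_axialProd_eq {v : ℕ → EuclideanSpace ℝ (Fin 3)} {p : EuclideanSpace ℝ (Fin 3)}
    (h : ∀ j, 0 < ‖p‖ ^ 2 * ‖v j‖ ^ 2 - inner ℝ p (v j) ^ 2) (n : ℕ) :
    ∃ r : ℝ, 0 < r ∧ (r : ℂ) * ∏ j ∈ Finset.range n, axialProd p (v j) (v (j + 1)) =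
      axialProd p (v 0) (v n) := by
  induction n with
  | zero =>
    refine ⟨_, h 0, ?_⟩
    rw [axialProd_self]; simp
  | succ n ih =>
    obtain ⟨r, hr, e⟩ := ih
    refine ⟨r / (‖p‖ ^ 2 * ‖v n‖ ^ 2 - inner ℝ p (v n) ^ 2), div_pos hr (h n), ?_⟩
    have hn : ((‖p‖ ^ 2 * ‖v n‖ ^ 2 - inner ℝ p (v n) ^ 2 : ℝ) : ℂ) ≠ 0 :=
      Complex.ofReal_ne_zero.2 (h n).ne'
    have := axialProd_mul p (v 0) (v n) (v (n + 1))
    rw [axialProd_self, ← e] at this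
    rw [Finset.prod_range_succ, Complex.ofReal_div]
    field_simp
    linear_combination this

/-- A polygonal curve ending at the antipode of its start turns by an odd multiple of `π` around
any axis that it avoids. -/
theorem axialAngle_ne_zero {v : ℕ → EuclideanSpace ℝ (Fin 3)} {n : ℕ}
    {p : EuclideanSpace ℝ (Fin 3)} (hv : v n = -v 0)
    (h : ∀ j, 0 < ‖p‖ ^ 2 * ‖v j‖ ^ 2 - inner ℝ p (v j) ^ 2) : axialAngle v n p ≠ 0 := by
  intro h0
  obtain ⟨r, hr, e⟩ := exists_prod_axialProd_eq h n
  have hprod : ∏ j ∈ Finset.range n, axialProd p (v j) (v (j + 1)) =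
      ((∏ j ∈ Finset.range n, ‖axialProd p (v j) (v (j + 1))‖ : ℝ) : ℂ) := by
    calc _ = ∏ j ∈ Finset.range n, ((‖axialProd p (v j) (v (j + 1))‖ : ℂ) *
          Complex.exp ((axialProd p (v j) (v (j + 1))).arg * Complex.I)) :=
          Finset.prod_congr rfl fun j _ => (Complex.norm_mul_exp_arg_mul_I _).symm
      _ = _ := by
          rw [Finset.prod_mul_distrib, ← Complex.exp_sum, ← Finset.sum_mul, ← Complex.ofReal_sum]
          change _ * Complex.exp ((axialAngle v n p : ℝ) * Complex.I) = _
          rw [h0]; simp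
  -- Zero total angle makes the product a nonnegative real, but it is a positive multiple of
  -- `axialProd p (v 0) (-v 0) < 0`.
  rw [hprod, hv, axialProd_neg_right, axialProd_self, ← Complex.ofReal_mul, ← Complex.ofReal_neg,
    Complex.ofReal_inj] at e
  have : 0 ≤ ∏ j ∈ Finset.range n, ‖axialProd p (v j) (v (j + 1))‖ :=
    Finset.prod_nonneg fun j _ => norm_nonneg _
  nlinarith [h 0, mul_nonneg hr.le this]

theorem continuous_axialProd (u v : EuclideanSpace ℝ (Fin 3)) :
    Continuous fun p => axialProd p u v := by
  have : (fun p => axialProd p u v) = fun p => (((axialProd p u v).re : ℝ) : ℂ) +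
      ((axialProd p u v).im : ℝ) * Complex.I := by
    ext p; exact (Complex.re_add_im _).symm
  rw [this]
  simp only [axialProd]
  fun_prop

/-- Two polygonal curves in space, each ending at the antipode of its start, contain parallel
vectors. -/
theorem exists_parallel_of_antipodal {u v : ℕ → EuclideanSpace ℝ (Fin 3)} {m n : ℕ}
    (hu : u m = -u 0) (hv : v n = -v 0) :
    ∃ i j, ∃ s ∈ Set.Icc (0 : ℝ) 1, ∃ t ∈ Set.Icc (0 : ℝ) 1,
      inner ℝ ((1 - s) • u i + s • u (i + 1)) ((1 - t) • v j + t • v (j + 1)) ^ 2 =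
      ‖(1 - s) • u i + s • u (i + 1)‖ ^ 2 * ‖(1 - t) • v j + t • v (j + 1)‖ ^ 2 := by
  by_contra! H
  have hs : ∀ i, ∀ s ∈ Set.Icc (0 : ℝ) 1, ∀ j,
      axialProd ((1 - s) • u i + s • u (i + 1)) (v j) (v (j + 1)) ∈ Complex.slitPlane := by
    intro i s hs j
    by_contra h
    obtain ⟨t, ht, e⟩ := exists_parallel_of_axialProd_notMem h
    exact H i j s hs t ht e
  have hp : ∀ i, ∀ s ∈ Set.Icc (0 : ℝ) 1, ∀ j, 0 < ‖(1 - s) • u i + s • u (i + 1)‖ ^ 2 *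
      ‖v j‖ ^ 2 - inner ℝ ((1 - s) • u i + s • u (i + 1)) (v j) ^ 2 := by
    intro i s hs j
    have h1 := H i j s hs 0 (by simp)
    have h2 := abs_real_inner_le_norm ((1 - s) • u i + s • u (i + 1)) (v j)
    simp only [sub_zero, one_smul, zero_smul, add_zero] at h1
    rw [sub_pos]
    refine lt_of_le_of_ne ?_ h1
    rw [← mul_pow, ← sq_abs (inner ℝ _ (v j))]
    gcongr
  have hne : ∀ i, ∀ s ∈ Set.Icc (0 : ℝ) 1,
      axialAngle v n ((1 - s) • u i + s • u (i + 1)) ≠ 0 := fun i s h =>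
    axialAngle_ne_zero hv (hp i s h)
  have hcont : ∀ i, ContinuousOn
      (fun s : ℝ => axialAngle v n ((1 - s) • u i + s • u (i + 1))) (Set.Icc 0 1) := by
    intro i
    refine continuousOn_finsetSum _ fun j _ s h => ?_
    refine ContinuousAt.continuousWithinAt ?_
    refine (Complex.continuousAt_arg (hs i s h j)).comp
      (f := fun s : ℝ => axialProd ((1 - s) • u i + s • u (i + 1)) (v j) (v (j + 1))) ?_
    exact ((continuous_axialProd (v j) (v (j + 1))).comp
      (f := fun s : ℝ => (1 - s) • u i + s • u (i + 1)) (by fun_prop)).continuousAt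
  -- A sign change along the curve would force a zero by the intermediate value theorem.
  have hsign : ∀ i, 0 < axialAngle v n (u 0) * axialAngle v n (u i) := by
    have h0 : ∀ i, axialAngle v n (u i) ≠ 0 := fun i => by simpa using hne i 0 (by simp)
    intro i
    induction i with
    | zero => exact mul_self_pos.2 (h0 0)
    | succ i ih =>
      have hpos : 0 < axialAngle v n (u i) * axialAngle v n (u (i + 1)) := by
        by_contra hle
        have hlt := lt_of_le_of_ne (not_lt.1 hle) (mul_ne_zero (h0 i) (h0 (i + 1)))
        have hmem : (0 : ℝ) ∈ Set.uIcc (axialAngle v n (u i)) (axialAngle v n (u (i + 1))) := by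
          rw [Set.mem_uIcc]
          rcases mul_neg_iff.1 hlt with h | h
          · exact Or.inr ⟨h.2.le, h.1.le⟩
          · exact Or.inl ⟨h.1.le, h.2.le⟩
        have := intermediate_value_uIcc (a := (0 : ℝ)) (b := 1)
          (by simpa [Set.uIcc_of_le] using hcont i)
        simp only [sub_zero, one_smul, zero_smul, add_zero, sub_self, zero_add] at this
        obtain ⟨s, hs', e⟩ := this hmem
        rw [Set.uIcc_of_le zero_le_one] at hs'
        exact hne i s hs' e
      have := mul_pos ih hpos
      have h2 : 0 < axialAngle v n (u i) ^ 2 := by have := h0 i; positivity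
      nlinarith
  have hm := hsign m
  rw [hu, axialAngle_neg (by simpa using hs 0 0 (by simp))] at hm
  nlinarith [mul_self_nonneg (axialAngle v n (u 0))]

/-! ### Distances that exclude parallel vectors -/

/-- The squared distance from `a` to a point of the segment between `b` and `c`. -/
theorem sq_norm_sub_segment {E : Type*} [NormedAddCommGroup E] [InnerProductSpace ℝ E]
    (a b c : E) (s : ℝ) :
    ‖a - ((1 - s) • b + s • c)‖ ^ 2 + (1 - s) * s * ‖b - c‖ ^ 2 =
      (1 - s) * ‖a - b‖ ^ 2 + s * ‖a - c‖ ^ 2 := by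
  have h : a - ((1 - s) • b + s • c) = (1 - s) • (a - b) + s • (a - c) := by module
  have h' : b - c = (a - c) - (a - b) := by abel
  rw [h, h']
  simp only [← real_inner_self_eq_norm_sq, inner_add_left, inner_add_right, inner_sub_left,
    inner_sub_right, inner_smul_left, inner_smul_right, RCLike.conj_to_real, real_inner_comm a b,
    real_inner_comm a c, real_inner_comm b c]
  ring

theorem sq_norm_sub_segment_le {E : Type*} [NormedAddCommGroup E] [InnerProductSpace ℝ E]
    {a b c : E} {s r : ℝ} (hs : s ∈ Set.Icc (0 : ℝ) 1) (hb : ‖a - b‖ ^ 2 ≤ r)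
    (hc : ‖a - c‖ ^ 2 ≤ r) :
    ‖a - ((1 - s) • b + s • c)‖ ^ 2 + (1 - s) * s * ‖b - c‖ ^ 2 ≤ r := by
  rw [sq_norm_sub_segment]
  nlinarith [hs.1, hs.2]

theorem lt_sq_norm_sub_segment {E : Type*} [NormedAddCommGroup E] [InnerProductSpace ℝ E]
    {a b c : E} {s r : ℝ} (hs : s ∈ Set.Icc (0 : ℝ) 1) (hb : r < ‖a - b‖ ^ 2)
    (hc : r < ‖a - c‖ ^ 2) :
    r < ‖a - ((1 - s) • b + s • c)‖ ^ 2 + (1 - s) * s * ‖b - c‖ ^ 2 := by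
  rw [sq_norm_sub_segment]
  rcases eq_or_lt_of_le hs.1 with h | h
  · subst h; simpa using hb
  · nlinarith [hs.2]

/-- If `x` is far from `x₁, x₂` and `y` is far from `y₁, y₂`, while `x, x₁, x₂` are close to
`y, y₁, y₂`, then no line from `x` to the segment `x₁ x₂` is parallel to a line from `y` to the
segment `y₁ y₂`. -/
theorem not_parallel_of_far_of_close {E : Type*} [NormedAddCommGroup E] [InnerProductSpace ℝ E]
    {x x₁ x₂ y y₁ y₂ : E} {s t : ℝ} (hs : s ∈ Set.Icc (0 : ℝ) 1) (ht : t ∈ Set.Icc (0 : ℝ) 1)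
    (hx₁ : 2 < ‖x - x₁‖) (hx₂ : 2 < ‖x - x₂‖) (hy₁ : 2 < ‖y - y₁‖) (hy₂ : 2 < ‖y - y₂‖)
    (h : ∀ a ∈ ({x, x₁, x₂} : Set E), ∀ b ∈ ({y, y₁, y₂} : Set E), ‖a - b‖ ≤ 2) :
    inner ℝ (x - ((1 - s) • x₁ + s • x₂)) (y - ((1 - t) • y₁ + t • y₂)) ^ 2 ≠
      ‖x - ((1 - s) • x₁ + s • x₂)‖ ^ 2 * ‖y - ((1 - t) • y₁ + t • y₂)‖ ^ 2 := by
  intro hpar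
  have sq_le : ∀ a ∈ ({x, x₁, x₂} : Set E), ∀ b ∈ ({y, y₁, y₂} : Set E), ‖a - b‖ ^ 2 ≤ 4 :=
    fun a ha b hb => by nlinarith [h a ha b hb, norm_nonneg (a - b)]
  have lt_sq : ∀ r : ℝ, 2 < r → 4 < r ^ 2 := fun r hr => by nlinarith
  set V := (1 - s) * s * ‖x₁ - x₂‖ ^ 2 with hV
  set W := (1 - t) * t * ‖y₁ - y₂‖ ^ 2 with hW
  have hV0 : 0 ≤ V := mul_nonneg (mul_nonneg (by linarith [hs.2]) hs.1) (sq_nonneg _)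
  have hW0 : 0 ≤ W := mul_nonneg (mul_nonneg (by linarith [ht.2]) ht.1) (sq_nonneg _)
  set z := (1 - s) • x₁ + s • x₂ with hz
  set w := (1 - t) • y₁ + t • y₂ with hw
  have hA : 4 < ‖x - z‖ ^ 2 + V := lt_sq_norm_sub_segment hs (lt_sq _ hx₁) (lt_sq _ hx₂)
  have hB : 4 < ‖y - w‖ ^ 2 + W := lt_sq_norm_sub_segment ht (lt_sq _ hy₁) (lt_sq _ hy₂)
  have hzb : ∀ b ∈ ({y, y₁, y₂} : Set E), ‖z - b‖ ^ 2 + V ≤ 4 := by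
    intro b hb
    rw [norm_sub_rev]
    refine sq_norm_sub_segment_le hs ?_ ?_ <;> rw [norm_sub_rev] <;>
      exact sq_le _ (by simp) _ hb
  have hxw : ‖x - w‖ ^ 2 + W ≤ 4 :=
    sq_norm_sub_segment_le ht (sq_le _ (by simp) _ (by simp)) (sq_le _ (by simp) _ (by simp))
  have hyz : ‖z - y‖ ^ 2 + V ≤ 4 := hzb _ (by simp)
  have hzw : ‖z - w‖ ^ 2 + W ≤ 4 - V :=
    sq_norm_sub_segment_le ht (by linarith [hzb y₁ (by simp)]) (by linarith [hzb y₂ (by simp)])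
  have hxy : ‖x - y‖ ≤ 2 := h _ (by simp) _ (by simp)
  have nA := norm_nonneg (x - z)
  have nB := norm_nonneg (y - w)
  rw [← mul_pow, sq_eq_sq_iff_eq_or_eq_neg] at hpar
  rcases hpar with hpar | hpar
  -- Same direction: the lengths add up, but `x - w` and `z - y` are too short; the `V`, `W`
  -- corrections cancel in each comparison.
  · have e : ‖(x - z) + (y - w)‖ = ‖x - z‖ + ‖y - w‖ := by
      rw [← sq_eq_sq₀ (norm_nonneg _) (by positivity), norm_add_sq_real, hpar]; ring
    have e' : (x - z) + (y - w) = (x - w) - (z - y) := by abel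
    have tri := norm_sub_le (x - w) (z - y)
    rw [← e', e] at tri
    have l1 : ‖z - y‖ < ‖x - z‖ := lt_of_pow_lt_pow_left₀ 2 nA (by linarith)
    have l2 : ‖x - w‖ < ‖y - w‖ := lt_of_pow_lt_pow_left₀ 2 nB (by linarith)
    linarith
  · have e : ‖(x - z) - (y - w)‖ = ‖x - z‖ + ‖y - w‖ := by
      rw [← sq_eq_sq₀ (norm_nonneg _) (by positivity), norm_sub_sq_real, hpar]; ring
    have e' : (x - z) - (y - w) = (x - y) - (z - w) := by abel
    have tri := norm_sub_le (x - y) (z - w)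
    rw [← e', e] at tri
    have l1 : ‖z - w‖ < ‖x - z‖ := lt_of_pow_lt_pow_left₀ 2 nA (by linarith)
    have l2 : ‖z - w‖ < ‖y - w‖ := lt_of_pow_lt_pow_left₀ 2 nB (by linarith)
    have lA : ‖x - z‖ < 2 := by linarith
    have lB : ‖y - w‖ < 2 := by linarith
    have n3 := norm_nonneg (z - w)
    have hsum : 4 + ‖z - w‖ ^ 2 < ‖x - z‖ ^ 2 + ‖y - w‖ ^ 2 := by linarith
    -- With `A`, `B` the two lengths, squaring `A + B - 2 ≤ ‖z - w‖` and using `hsum` gives `(2 - A)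
    -- * (2 - B) < 0`.
    rcases le_total 2 (‖x - z‖ + ‖y - w‖) with h2 | h2
    · have : (‖x - z‖ + ‖y - w‖ - 2) ^ 2 ≤ ‖z - w‖ ^ 2 :=
        pow_le_pow_left₀ (by linarith) (by linarith) 2
      nlinarith [mul_pos (sub_pos.2 lA) (sub_pos.2 lB)]
    · nlinarith [mul_nonneg nA nB]

/-! ### From odd closed sequences to graphs -/

/-- Two odd closed sequences of points of space with steps longer than `2` contain two points, one
of each, at distance more than `2`. -/
theorem exists_two_lt_dist_of_odd_periodic {x y : ℕ → EuclideanSpace ℝ (Fin 3)} {m n : ℕ}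
    (hm : Odd m) (hn : Odd n) (hxm : ∀ i, x (i + m) = x i) (hyn : ∀ i, y (i + n) = y i)
    (hx : ∀ i, 2 < dist (x i) (x (i + 1))) (hy : ∀ i, 2 < dist (y i) (y (i + 1))) :
    ∃ i j, 2 < dist (x i) (y j) := by
  by_contra! h
  have anti : ∀ {z : ℕ → EuclideanSpace ℝ (Fin 3)} {k : ℕ}, Odd k → (∀ i, z (i + k) = z i) →
      (-1 : ℝ) ^ k • (z (k + 1) - z k) = -((-1 : ℝ) ^ 0 • (z (0 + 1) - z 0)) := by
    intro z k hk hz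
    have h0 := hz 0
    have h1 := hz 1
    rw [zero_add] at h0
    rw [add_comm] at h1
    rw [hk.neg_one_pow, h0, h1]
    simp
  -- Alternating signs turn a point between consecutive steps into a vector, up to sign, from the
  -- segment of the two neighbors to the middle vertex.
  have seg : ∀ (z : ℕ → EuclideanSpace ℝ (Fin 3)) (i : ℕ) (s : ℝ),
      (1 - s) • ((-1 : ℝ) ^ i • (z (i + 1) - z i)) +
        s • ((-1 : ℝ) ^ (i + 1) • (z (i + 1 + 1) - z (i + 1))) =
      (-1 : ℝ) ^ i • (z (i + 1) - ((1 - s) • z i + s • z (i + 1 + 1))) := by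
    intro z i s
    rw [pow_succ]
    module
  obtain ⟨i, j, s, hs, t, ht, e⟩ := exists_parallel_of_antipodal
    (u := fun i => (-1 : ℝ) ^ i • (x (i + 1) - x i))
    (v := fun i => (-1 : ℝ) ^ i • (y (i + 1) - y i)) (anti hm hxm) (anti hn hyn)
  simp only [seg, inner_smul_left, inner_smul_right, norm_smul, mul_pow, RCLike.conj_to_real,
    norm_pow, norm_neg, norm_one, one_pow, one_mul, ← pow_mul, mul_comm _ 2, pow_mul (-1 : ℝ) 2,
    neg_one_sq] at e
  refine not_parallel_of_far_of_close hs ht ?_ ?_ ?_ ?_ ?_ e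
  · rw [← dist_eq_norm, dist_comm]; exact hx i
  · rw [← dist_eq_norm]; exact hx (i + 1)
  · rw [← dist_eq_norm, dist_comm]; exact hy j
  · rw [← dist_eq_norm]; exact hy (j + 1)
  · simp only [← dist_eq_norm]
    rintro a (rfl | rfl | rfl) b (rfl | rfl | rfl) <;> exact h _ _

theorem closedBall_inter_closedBall_nonempty_iff {E : Type*} [NormedAddCommGroup E]
    [NormedSpace ℝ E] (a b : E) :
    (Metric.closedBall a 1 ∩ Metric.closedBall b 1).Nonempty ↔ dist a b ≤ 2 := by
  constructor
  · rintro ⟨c, ha, hb⟩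
    rw [Metric.mem_closedBall'] at ha
    rw [Metric.mem_closedBall] at hb
    linarith [dist_triangle a c b]
  · intro h
    refine ⟨midpoint ℝ a b, ?_, ?_⟩
    · rw [Metric.mem_closedBall, dist_midpoint_left]; norm_num; linarith
    · rw [Metric.mem_closedBall, dist_midpoint_right]; norm_num; linarith

/-- In the complement of a unit ball graph, two odd closed walks meet or are joined by an edge. -/
theorem IsUnitBallGraph.exists_eq_or_compl_adj {V : Type*} {G : SimpleGraph V}
    (hG : IsUnitBallGraph G) {x y : ℕ → V} {m n : ℕ} (hm : Odd m) (hn : Odd n)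
    (hxm : ∀ i, x (i + m) = x i) (hyn : ∀ i, y (i + n) = y i)
    (hx : ∀ i, Gᶜ.Adj (x i) (x (i + 1))) (hy : ∀ i, Gᶜ.Adj (y i) (y (i + 1))) :
    ∃ i j, x i = y j ∨ Gᶜ.Adj (x i) (y j) := by
  obtain ⟨c, hc⟩ := hG
  simp only [closedBall_inter_closedBall_nonempty_iff] at hc
  have far : ∀ {a b}, Gᶜ.Adj a b → 2 < dist (c a) (c b) := by
    intro a b hab
    rw [SimpleGraph.compl_adj, hc] at hab
    by_contra hle
    exact hab.2 ⟨hab.1, not_lt.1 hle⟩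
  obtain ⟨i, j, hij⟩ := exists_two_lt_dist_of_odd_periodic (x := fun i => c (x i))
    (y := fun i => c (y i)) hm hn (fun i => by simp only [hxm]) (fun i => by simp only [hyn])
    (fun i => far (hx i)) (fun i => far (hy i))
  refine ⟨i, j, or_iff_not_imp_left.2 fun hne => ?_⟩
  rw [SimpleGraph.compl_adj, hc]
  exact ⟨hne, fun h => absurd h.2 (not_le.2 hij)⟩

theorem SimpleGraph.Walk.exists_periodic {V : Type*} {G : SimpleGraph V} {v : V} (w : G.Walk v v)
    (hw : 0 < w.length) :
    ∃ x : ℕ → V, (∀ i, x (i + w.length) = x i) ∧ (∀ i, G.Adj (x i) (x (i + 1))) ∧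
      ∀ i, x i ∈ w.support := by
  refine ⟨fun i => w.getVert (i % w.length), fun i => by simp, fun i => ?_,
    fun i => w.getVert_mem_support _⟩
  have hlt := Nat.mod_lt i hw
  have hadj := w.adj_getVert_succ hlt
  -- The last edge wraps around to index 0.
  rcases eq_or_lt_of_le (Nat.succ_le_of_lt hlt) with h | h
  · have h0 : (i + 1) % w.length = 0 := by
      rw [← Nat.mod_add_mod, ← Nat.succ_eq_add_one, h, Nat.mod_self]
    have e : w.getVert (i % w.length + 1) = v := by
      rw [← Nat.succ_eq_add_one, h, SimpleGraph.Walk.getVert_length]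
    simpa only [h0, SimpleGraph.Walk.getVert_zero, e] using hadj
  · have h1 : (i + 1) % w.length = i % w.length + 1 := by
      rw [← Nat.mod_add_mod, Nat.mod_eq_of_lt h]
    simpa only [h1] using hadj

theorem SimpleGraph.exists_periodic_cycleGraph {n : ℕ} (hn : 3 ≤ n) :
    ∃ x : ℕ → Fin n, (∀ i, x (i + n) = x i) ∧
      ∀ i, (SimpleGraph.cycleGraph n).Adj (x i) (x (i + 1)) := by
  obtain ⟨k, rfl⟩ : ∃ k, n = k + 2 := ⟨n - 2, by omega⟩
  refine ⟨fun i => Fin.ofNat (k + 2) i, fun i => by simp [Fin.ext_iff], fun i => ?_⟩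
  rw [SimpleGraph.cycleGraph_adj]
  right
  rw [sub_eq_iff_eq_add']
  simp [Fin.ext_iff, Fin.val_add]

theorem theorem3 {V : Type*} (G : SimpleGraph V) (hG : IsUnitBallGraph G) :
    (∀ p q : ℕ, 3 ≤ p → Odd p → 3 ≤ q → Odd q →
      ¬ (SimpleGraph.sum (SimpleGraph.cycleGraph p) (SimpleGraph.cycleGraph q)).IsIndContained Gᶜ) ∧
    iocp Gᶜ ≤ 1 := by
  constructor
  · rintro p q hp hpo hq hqo ⟨f⟩
    obtain ⟨x, hxp, hx⟩ := SimpleGraph.exists_periodic_cycleGraph hp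
    obtain ⟨y, hyq, hy⟩ := SimpleGraph.exists_periodic_cycleGraph hq
    obtain ⟨i, j, h | h⟩ := hG.exists_eq_or_compl_adj (x := fun i => f (Sum.inl (x i)))
      (y := fun i => f (Sum.inr (y i))) hpo hqo (fun i => by simp only [hxp])
      (fun i => by simp only [hyq])
      (fun i => f.map_adj_iff.2 (by simpa using hx i))
      (fun i => f.map_adj_iff.2 (by simpa using hy i))
    · simpa using f.injective h
    · simpa using f.map_adj_iff.1 h
  · refine sSup_le ?_
    rintro _ ⟨k, C, ⟨hC, hC'⟩, rfl⟩
    by_contra hk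
    have hk2 : 1 < k := by
      rw [not_le] at hk
      exact_mod_cast hk
    obtain ⟨x, hxp, hx, hxs⟩ := (C ⟨0, by omega⟩).2.exists_periodic (hC _).2.pos
    obtain ⟨y, hyq, hy, hys⟩ := (C ⟨1, hk2⟩).2.exists_periodic (hC _).2.pos
    obtain ⟨i, j, h⟩ := hG.exists_eq_or_compl_adj (hC _).2 (hC _).2 hxp hyq hx hy
    have := hC' ⟨0, by omega⟩ ⟨1, hk2⟩ (by simp) _ (hxs i) _ (hys j)
    exact h.elim this.1 this.2
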